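/- Let $M$ be a von Neumann algebra with a faithful normal tracial state $\tau$. Let $L^2(M)$ be the completion of $M$ for the inner product $\langle x,y\rangle=\tau(y^*x)$, so that $M\subseteq L^2(M)$, and let $J$ be the antilinear isometry of $L^2(M)$ extending $x\mapsto x^*$. The algebra $M$ acts on $L^2(M)$ by left multiplication, and $x^{\rm op}:=Jx^*J$ ($x\in M$) is right multiplication by $x$; for a unital von Neumann subalgebra $B\subseteq M$ put $B^{\rm op}=\{b^{\rm op}: b\in B\}$. For $T\in\mathcal B(L^2(M))$ let $Q_0(T)\in\mathcal B(M,L^2(M))$ be the map $x\mapsto T(x)$, where $M$ carries its operator norm. Let $\mathcal K_M^L$ be the closed left ideal of all $T\in\mathcal B(L^2(M))$ for which $Q_0(T)$ is a compact operator, let $\mathcal K_M=\mathcal K_M^L\cap(\mathcal K_M^L)^*$, and let $\mathcal M(\mathcal K_M)=\{T\in\mathcal B(L^2(M)): T\mathcal K_M\subseteq\mathcal K_M,\ \mathcal K_MT\subseteq\mathcal K_M\}$ be its multiplier algebra, which contains $M$ and $M^{\rm op}$. One says that $M$ has W$^*$AO if the linear map $$\theta: M\otimes_{\rm alg}M^{\rm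 op}\to\mathcal M(\mathcal K_M)/\mathcal K_M,\qquad a\otimes b^{\rm op}\mapsto ab^{\rm op}+\mathcal K_M,$$ is continuous with respect to the minimal tensor norm on $M\otimes_{\rm alg}M^{\rm op}$ and the quotient norm. For a linear subspace $V\subseteq M$ (with the norm of $M$) let $L^2(V)$ denote the closure of $V$ in $L^2(M)$. Theorem. Suppose there exist a unital von Neumann subalgebra $B\subseteq M$ and linear subspaces $M_i\subseteq M$, $i\in\mathbb N$, that are left and right $B$-invariant and mutually $\tau$-orthogonal, i.e. $\tau(y^*x)=0$ whenever $x\in M_i$, $y\in M_j$, $i\neq j$. Suppose moreover that there exist $\delta>0$ and finitely many $b_j,c_j\in B$ with $\sum_j b_j\otimes c_j^{\rm op}\neq 0$ in $B\otimes_{\rm alg}B^{\rm op}$ such that for every $i\in\mathbb N$ $$\Big\|Q_0\Big(\sum_j b_jc_j^{\rm op}\Big)\Big\|_{\mathcal B(M_i,L^2(M_i))}\ \ge\ (1+\delta)\,\Big\|\sum_j b_j\otimes c_j^{\rm op}\Big\|_{B\otimes_{\min}B^{\rm op}}.$$ Then $M$ does not have W$^*$AO. -/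

import Mathlib

open scoped ComplexOrder TensorProduct InnerProductSpace
open UniformSpace MulOpposite

noncomputable section

/-! ### The minimal tensor norm -/

section MinimalTensorNorm

variable {A₁ A₂ H₁ H₂ : Type*}
  [NormedAddCommGroup H₁] [InnerProductSpace ℂ H₁] [CompleteSpace H₁]
  [NormedAddCommGroup H₂] [InnerProductSpace ℂ H₂] [CompleteSpace H₂]
  [Ring A₁] [StarRing A₁] [Algebra ℂ A₁] [Ring A₂] [StarRing A₂] [Algebra ℂ A₂]

/-- The map `a ⊗ b ↦ π(a) ⊗ ρ(b)`, with values in the bounded operators on `H₁ ⊗ H₂`. -/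
def spatialRep (π : A₁ →⋆ₐ[ℂ] (H₁ →L[ℂ] H₁)) (ρ : A₂ →⋆ₐ[ℂ] (H₂ →L[ℂ] H₂)) :
    A₁ ⊗[ℂ] A₂ →ₗ[ℂ] (H₁ ⊗[ℂ] H₂ →L[ℂ] H₁ ⊗[ℂ] H₂) :=
  TensorProduct.lift <| LinearMap.mk₂ ℂ (fun a b => TensorProduct.mapL (π a) (ρ b))
    (fun a a' b => by ext x; simp [TensorProduct.map_add_left])
    (fun r a b => by ext x; simp [TensorProduct.map_smul_left])
    (fun a b b' => by ext x; simp [TensorProduct.map_add_right])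
    (fun r a b => by ext x; simp [TensorProduct.map_smul_right])

/-- The minimal (spatial) tensor norm on the algebraic tensor product `A₁ ⊗ A₂` of C⋆-algebras,
computed in faithful representations `π` of `A₁` on `H₁` and `ρ` of `A₂` on `H₂`: the operator norm
of `∑ π(a_j) ⊗ ρ(b_j)` on `H₁ ⊗ H₂`. The operator norm on the algebraic tensor product of the
Hilbert spaces `H₁`, `H₂` is the operator norm of the extension to its completion. -/
def minTensorNorm (π : A₁ →⋆ₐ[ℂ] (H₁ →L[ℂ] H₁)) (ρ : A₂ →⋆ₐ[ℂ] (H₂ →L[ℂ] H₂))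
    (u : A₁ ⊗[ℂ] A₂) : ℝ := ‖spatialRep π ρ u‖

end MinimalTensorNorm

/-- A unital `⋆`-homomorphism `B → A`, viewed as a `⋆`-homomorphism `B^op → A^op`. -/
def opStarHom {A B : Type*} [Ring A] [StarRing A] [Algebra ℂ A] [Ring B] [StarRing B]
    [Algebra ℂ B] (f : B →⋆ₐ[ℂ] A) : Bᵐᵒᵖ →⋆ₐ[ℂ] Aᵐᵒᵖ where
  __ := AlgHom.op f.toAlgHom
  map_star' x := congrArg op (map_star f (unop x))

/-! ### The standard form `L²(A)` of a faithful tracial state: left and right multiplication -/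

/-- `τ` (a positive linear functional) is a faithful tracial state on the unital C⋆-algebra `A`. -/
structure IsFaithfulTracialState {A : Type*} [CStarAlgebra A] [PartialOrder A]
    (τ : A →ₚ[ℂ] ℂ) : Prop where
  map_one : τ 1 = 1
  tracial : ∀ x y, τ (x * y) = τ (y * x)
  faithful : ∀ x, τ (star x * x) = 0 → x = 0

namespace IsFaithfulTracialState

variable {A : Type*} [CStarAlgebra A] [PartialOrder A] [StarOrderedRing A]

/-- `L²(A)`: the completion of `A` for the inner product `τ(y⋆ x)`
(Mathlib's inner product `⟪y, x⟫` is conjugate linear in its first argument). -/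
abbrev L2 (τ : A →ₚ[ℂ] ℂ) : Type _ := τ.GNS

/-- The action of `A` on `L²(A)` by left multiplication. -/
abbrev leftRep (τ : A →ₚ[ℂ] ℂ) : A →⋆ₐ[ℂ] (L2 τ →L[ℂ] L2 τ) := τ.gnsStarAlgHom

variable {τ : A →ₚ[ℂ] ℂ} (hτ : IsFaithfulTracialState τ)

lemma norm_toPreGNS_le (hτ : IsFaithfulTracialState τ) (x : A) : ‖τ.toPreGNS x‖ ≤ ‖x‖ := by
  have h := (τ.leftMulMapPreGNS x).le_opNorm (τ.toPreGNS 1)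
  have h1 : ‖τ.toPreGNS (1 : A)‖ = 1 := by
    simp [PositiveLinearMap.preGNS_norm_def, hτ.map_one]
  have h2 : ‖τ.leftMulMapPreGNS x‖ ≤ ‖x‖ := LinearMap.mkContinuous_norm_le _ (norm_nonneg _) _
  rw [h1, mul_one] at h
  simpa using h.trans h2

/-- The canonical map `A → L²(A)`. -/
def toL2 : A →L[ℂ] L2 τ :=
  LinearMap.mkContinuous
    { toFun := fun x => ((τ.toPreGNS x : τ.PreGNS) : L2 τ)
      map_add' := fun x y => by rw [map_add, Completion.coe_add]
      map_smul' := fun r x => by rw [map_smul, Completion.coe_smul, RingHom.id_apply] } 1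
    fun x => by
      rw [one_mul, LinearMap.coe_mk, AddHom.coe_mk, Completion.norm_coe]
      exact norm_toPreGNS_le hτ x

lemma toL2_apply (x : A) : toL2 hτ x = (τ.toPreGNS x : L2 τ) := rfl

lemma inner_toL2 (x y : A) : ⟪toL2 hτ y, toL2 hτ x⟫_ℂ = τ (star y * x) := by
  rw [toL2_apply, toL2_apply, Completion.inner_coe]
  rfl

lemma denseRange_toL2 : DenseRange (toL2 hτ) :=
  Completion.denseRange_coe.comp τ.toPreGNS.surjective.denseRange (Completion.continuous_coe _)

lemma leftRep_toL2 (a x : A) : leftRep τ a (toL2 hτ x) = toL2 hτ (a * x) := by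
  simp [toL2_apply]

/-- The map `x ↦ x⋆` on the pre-Hilbert space `A`, an isometry because `τ` is tracial. -/
def preConj : τ.PreGNS →L⋆[ℂ] τ.PreGNS :=
  LinearMap.mkContinuous
    { toFun := fun x => τ.toPreGNS (star (τ.ofPreGNS x))
      map_add' := by simp
      map_smul' := by simp } 1 fun x => by
      rw [one_mul]
      simp [PositiveLinearMap.preGNS_norm_def, hτ.tracial (τ.ofPreGNS x)]

/-- The modular conjugation `J` of the standard form: the conjugate linear extension of `x ↦ x⋆`
to `L²(A)`. -/
def J : L2 τ →L⋆[ℂ] L2 τ := (preConj hτ).completion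

lemma J_toL2 (x : A) : J hτ (toL2 hτ x) = toL2 hτ (star x) := by
  simp [J, toL2_apply, preConj]

lemma J_J (ξ : L2 τ) : J hτ (J hτ ξ) = ξ :=
  (denseRange_toL2 hτ).induction_on ξ
    (isClosed_eq ((J hτ).continuous.comp (J hτ).continuous) continuous_id) fun x => by
      simp [J_toL2]

lemma inner_J (ξ η : L2 τ) : ⟪J hτ ξ, η⟫_ℂ = ⟪J hτ η, ξ⟫_ℂ := by
  refine (denseRange_toL2 hτ).induction_on₂ (p := fun ξ η => ⟪J hτ ξ, η⟫_ℂ = ⟪J hτ η, ξ⟫_ℂ)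
    ?_ ?_ ξ η
  · have := (J hτ).continuous
    exact isClosed_eq (by fun_prop) (by fun_prop)
  · intro x y
    simp only [J_toL2, inner_toL2, star_star]
    exact hτ.tracial _ _

/-- `x^op = J x⋆ J`, as a bounded operator on `L²(A)`. -/
def opOperator (x : A) : L2 τ →L[ℂ] L2 τ :=
  (J hτ).comp ((leftRep τ (star x)).comp (J hτ))

lemma opOperator_apply (x : A) (ξ : L2 τ) :
    opOperator hτ x ξ = J hτ (leftRep τ (star x) (J hτ ξ)) := rfl

/-- `x^op` is right multiplication by `x`. -/
lemma opOperator_toL2 (x y : A) : opOperator hτ x (toL2 hτ y) = toL2 hτ (y * x) := by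
  rw [opOperator_apply, J_toL2, leftRep_toL2, J_toL2, star_mul, star_star, star_star]

/-- The representation `x^op ↦ J x⋆ J` of the opposite algebra `A^op` on `L²(A)`. -/
def rightRep : Aᵐᵒᵖ →⋆ₐ[ℂ] (L2 τ →L[ℂ] L2 τ) where
  toFun x := opOperator hτ (unop x)
  map_one' := by
    ext ξ
    have h : leftRep τ 1 = 1 := _root_.map_one (leftRep τ)
    rw [opOperator_apply, unop_one, star_one, h]
    exact J_J hτ ξ
  map_mul' x y := by
    ext ξ
    rw [mul_apply_eq_comp]
    simp only [opOperator_apply, unop_mul, star_mul, map_mul, mul_apply_eq_comp, J_J]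
  map_zero' := by
    ext ξ
    rw [opOperator_apply, unop_zero, star_zero, map_zero]
    simp
  map_add' x y := by
    ext ξ
    rw [add_apply]
    simp only [opOperator_apply, unop_add, star_add, map_add, add_apply]
  commutes' r := by
    ext ξ
    have h : leftRep τ (star (algebraMap ℂ A r)) = star (algebraMap ℂ (L2 τ →L[ℂ] L2 τ) r) := by
      rw [map_star, AlgHomClass.commutes]
    rw [opOperator_apply, MulOpposite.algebraMap_apply, unop_op, h, ← algebraMap_star_comm,
      Algebra.algebraMap_eq_smul_one, Algebra.algebraMap_eq_smul_one,
      smul_apply, smul_apply,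
      ContinuousLinearMap.map_smulₛₗ]
    simp [J_J]
  map_star' x := by
    rw [ContinuousLinearMap.star_eq_adjoint]
    refine (ContinuousLinearMap.eq_adjoint_iff _ _).mpr fun ξ η => ?_
    have h : leftRep τ (star (unop x)) = (leftRep τ (unop x)).adjoint := by
      rw [map_star, ContinuousLinearMap.star_eq_adjoint]
    rw [opOperator_apply, opOperator_apply, unop_star, star_star, h, inner_J,
      ← inner_conj_symm ξ, inner_J hτ _ ξ, inner_conj_symm,
      ContinuousLinearMap.adjoint_inner_left]

lemma rightRep_toL2 (x y : A) :
    rightRep hτ (op x) (toL2 hτ y) = toL2 hτ (y * x) := opOperator_toL2 hτ x y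

lemma toL2_injective : Function.Injective (toL2 hτ) :=
  (injective_iff_map_eq_zero _).mpr fun x hx => hτ.faithful x <| by
    rw [← inner_toL2 hτ, hx, inner_zero_left]

lemma leftRep_injective (hτ : IsFaithfulTracialState τ) : Function.Injective (leftRep τ) :=
  (injective_iff_map_eq_zero _).mpr fun x hx => toL2_injective hτ <| by
    have h := leftRep_toL2 hτ x 1
    rw [hx, mul_one, zero_apply] at h
    rw [← h, _root_.map_zero]

lemma rightRep_injective : Function.Injective (rightRep hτ) :=
  (injective_iff_map_eq_zero _).mpr fun x hx => unop_injective <| toL2_injective hτ <| by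
    have h := rightRep_toL2 hτ (unop x) 1
    rw [op_unop, hx, one_mul, zero_apply] at h
    rw [← h, unop_zero, _root_.map_zero]

/-! ### The compactness ideals and their multiplier algebra -/

/-- `Q₀(T) ∈ B(A, L²(A))`, the map `x ↦ T(x)`, where `A` carries its C⋆-norm. -/
def Q0 (T : L2 τ →L[ℂ] L2 τ) : A →L[ℂ] L2 τ := T.comp (toL2 hτ)

/-- The closed left ideal `𝒦^L = {T | Q₀(T) is compact}` of `B(L²(A))`. -/
def compactLeftIdeal : Submodule ℂ (L2 τ →L[ℂ] L2 τ) where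
  carrier := {T | IsCompactOperator (Q0 hτ T)}
  add_mem' h₁ h₂ := h₁.add h₂
  zero_mem' := isCompactOperator_zero
  smul_mem' c _ h := h.smul c

lemma mem_compactLeftIdeal {T : L2 τ →L[ℂ] L2 τ} :
    T ∈ compactLeftIdeal hτ ↔ IsCompactOperator (Q0 hτ T) := Iff.rfl

lemma mul_mem_compactLeftIdeal (S : L2 τ →L[ℂ] L2 τ) {T : L2 τ →L[ℂ] L2 τ}
    (hT : T ∈ compactLeftIdeal hτ) : S * T ∈ compactLeftIdeal hτ :=
  IsCompactOperator.clm_comp (f := Q0 hτ T) hT S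

lemma mul_leftRep_mem_compactLeftIdeal {T : L2 τ →L[ℂ] L2 τ} (hT : T ∈ compactLeftIdeal hτ)
    (a : A) : T * leftRep τ a ∈ compactLeftIdeal hτ := by
  have h : (Q0 hτ (T * leftRep τ a) : A → L2 τ) = Q0 hτ T ∘ (ContinuousLinearMap.mul ℂ A a) := by
    ext x
    exact congrArg T (leftRep_toL2 hτ a x)
  rw [mem_compactLeftIdeal, h]
  exact IsCompactOperator.comp_clm hT _

lemma mul_rightRep_mem_compactLeftIdeal {T : L2 τ →L[ℂ] L2 τ} (hT : T ∈ compactLeftIdeal hτ)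
    (b : Aᵐᵒᵖ) : T * rightRep hτ b ∈ compactLeftIdeal hτ := by
  have h : (Q0 hτ (T * rightRep hτ b) : A → L2 τ) =
      Q0 hτ T ∘ ((ContinuousLinearMap.mul ℂ A).flip (unop b)) := by
    ext x
    exact congrArg T (rightRep_toL2 hτ (unop b) x)
  rw [mem_compactLeftIdeal, h]
  exact IsCompactOperator.comp_clm hT _

/-- The hereditary C⋆-subalgebra `𝒦 = 𝒦^L ∩ (𝒦^L)⋆` of `B(L²(A))`. -/
def compactAlgebra : NonUnitalStarSubalgebra ℂ (L2 τ →L[ℂ] L2 τ) where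
  carrier := {T | T ∈ compactLeftIdeal hτ ∧ star T ∈ compactLeftIdeal hτ}
  add_mem' h₁ h₂ := ⟨add_mem h₁.1 h₂.1, by rw [star_add]; exact add_mem h₁.2 h₂.2⟩
  zero_mem' := ⟨zero_mem _, by rw [star_zero]; exact zero_mem _⟩
  mul_mem' h₁ h₂ := ⟨mul_mem_compactLeftIdeal hτ _ h₂.1, by
    rw [star_mul]; exact mul_mem_compactLeftIdeal hτ _ h₁.2⟩
  smul_mem' c _ h := ⟨Submodule.smul_mem _ c h.1, by
    rw [star_smul]; exact Submodule.smul_mem _ _ h.2⟩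
  star_mem' h := ⟨h.2, by rw [star_star]; exact h.1⟩

lemma mem_compactAlgebra {T : L2 τ →L[ℂ] L2 τ} : T ∈ compactAlgebra hτ ↔
    T ∈ compactLeftIdeal hτ ∧ star T ∈ compactLeftIdeal hτ := Iff.rfl

/-- The multiplier algebra of `𝒦`, as the idealizer of `𝒦` in `B(L²(A))`
(`𝒦` acts nondegenerately since it contains all compact operators). -/
def multiplierAlgebra : StarSubalgebra ℂ (L2 τ →L[ℂ] L2 τ) where
  carrier := {T | ∀ K ∈ compactAlgebra hτ, T * K ∈ compactAlgebra hτ ∧ K * T ∈ compactAlgebra hτ}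
  mul_mem' {S T} hS hT K hK := by
    refine ⟨?_, ?_⟩
    · rw [mul_assoc]; exact (hS _ (hT K hK).1).1
    · rw [← mul_assoc]; exact (hT _ (hS K hK).2).2
  add_mem' {S T} hS hT K hK := by
    refine ⟨?_, ?_⟩
    · rw [add_mul]; exact add_mem (hS K hK).1 (hT K hK).1
    · rw [mul_add]; exact add_mem (hS K hK).2 (hT K hK).2
  algebraMap_mem' r K hK := by
    refine ⟨?_, ?_⟩
    · rw [← Algebra.smul_def]; exact SMulMemClass.smul_mem r hK
    · rw [← Algebra.commutes, ← Algebra.smul_def]; exact SMulMemClass.smul_mem r hK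
  star_mem' {T} hT K hK := by
    have h := hT (star K) (star_mem hK)
    refine ⟨?_, ?_⟩
    · simpa using star_mem h.2
    · simpa using star_mem h.1

/-- `𝒦` as a subspace (a two-sided ideal) of its multiplier algebra. -/
def compactIdeal : Submodule ℂ (multiplierAlgebra hτ) where
  carrier := {T | (T : L2 τ →L[ℂ] L2 τ) ∈ compactAlgebra hτ}
  add_mem' {S T} hS hT := show (S : L2 τ →L[ℂ] L2 τ) + T ∈ compactAlgebra hτ from add_mem hS hT
  zero_mem' := zero_mem (compactAlgebra hτ)
  smul_mem' c T h := show c • (T : L2 τ →L[ℂ] L2 τ) ∈ compactAlgebra hτ from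
    SMulMemClass.smul_mem (s := compactAlgebra hτ) c h

lemma leftRep_mem_multiplierAlgebra (a : A) : leftRep τ a ∈ multiplierAlgebra hτ := by
  intro K hK
  refine ⟨⟨mul_mem_compactLeftIdeal hτ _ hK.1, ?_⟩,
    ⟨mul_leftRep_mem_compactLeftIdeal hτ hK.1 a, ?_⟩⟩
  · rw [star_mul, ← map_star]
    exact mul_leftRep_mem_compactLeftIdeal hτ hK.2 _
  · rw [star_mul]
    exact mul_mem_compactLeftIdeal hτ _ hK.2

lemma rightRep_mem_multiplierAlgebra (b : Aᵐᵒᵖ) : rightRep hτ b ∈ multiplierAlgebra hτ := by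
  intro K hK
  refine ⟨⟨mul_mem_compactLeftIdeal hτ _ hK.1, ?_⟩,
    ⟨mul_rightRep_mem_compactLeftIdeal hτ hK.1 b, ?_⟩⟩
  · rw [star_mul, ← map_star]
    exact mul_rightRep_mem_compactLeftIdeal hτ hK.2 _
  · rw [star_mul]
    exact mul_mem_compactLeftIdeal hτ _ hK.2

/-! ### The property W⋆AO -/

/-- The map `A ⊗ A^op → ℳ(𝒦)`, `a ⊗ b^op ↦ a b^op`. -/
def multiplierMap : A ⊗[ℂ] Aᵐᵒᵖ →ₗ[ℂ] multiplierAlgebra hτ :=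
  TensorProduct.lift <| LinearMap.mk₂ ℂ
    (fun a b => (⟨leftRep τ a, leftRep_mem_multiplierAlgebra hτ a⟩ *
      ⟨rightRep hτ b, rightRep_mem_multiplierAlgebra hτ b⟩ : multiplierAlgebra hτ))
    (fun a a' b => Subtype.ext <| by simp [add_mul])
    (fun r a b => Subtype.ext <| by simp)
    (fun a b b' => Subtype.ext <| by simp [mul_add])
    (fun r a b => Subtype.ext <| by simp)

/-- The map `θ : A ⊗ A^op → ℳ(𝒦) ⧸ 𝒦`, `a ⊗ b^op ↦ a b^op + 𝒦`; the target carries the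
quotient norm. -/
def theta : A ⊗[ℂ] Aᵐᵒᵖ →ₗ[ℂ] (multiplierAlgebra hτ ⧸ compactIdeal hτ) :=
  (compactIdeal hτ).mkQ ∘ₗ multiplierMap hτ

/-- W⋆AO: the linear map `θ` is continuous (that is, bounded) for the minimal tensor norm on
`A ⊗ A^op`, computed in the representations of `A` and `A^op` on `L²(A)`. -/
def HasWStarAO : Prop :=
  ∃ C : ℝ, ∀ u : A ⊗[ℂ] Aᵐᵒᵖ, ‖theta hτ u‖ ≤ C * minTensorNorm (leftRep τ) (rightRep hτ) u

/-! ### Bimodules -/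

/-- `L²(V)`: the closure of the subspace `V ⊆ A` in `L²(A)`. -/
def L2Of (V : Submodule ℂ A) : Submodule ℂ (L2 τ) :=
  (V.map (toL2 hτ).toLinearMap).topologicalClosure

variable {B : Type*} [Ring B] [StarRing B] [Algebra ℂ B] (j : B →⋆ₐ[ℂ] A)

/-- `V ⊆ A` is left and right `B`-invariant, for a subalgebra `B` with inclusion `j : B → A`. -/
def IsBimodule (j : B →⋆ₐ[ℂ] A) (V : Submodule ℂ A) : Prop :=
  ∀ b : B, ∀ x ∈ V, j b * x ∈ V ∧ x * j b ∈ V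

/-- The minimal tensor norm of `B ⊗ B^op` for a subalgebra `j : B → A`, computed in the faithful
representations `b ↦ b` and `c^op ↦ c^op` of `B` and `B^op` on `L²(A)`. -/
def subalgebraMinNorm (u : B ⊗[ℂ] Bᵐᵒᵖ) : ℝ :=
  minTensorNorm ((leftRep τ).comp j) ((rightRep hτ).comp (opStarHom j)) u

/-- The operator `∑ b_j c_j^op` on `L²(A)` attached to `u = ∑ b_j ⊗ c_j^op` in `B ⊗ B^op`. -/
def bimoduleOperator (u : B ⊗[ℂ] Bᵐᵒᵖ) : L2 τ →L[ℂ] L2 τ :=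
  (multiplierMap hτ
    (TensorProduct.map j.toAlgHom.toLinearMap (opStarHom j).toAlgHom.toLinearMap u) :)

lemma bimoduleOperator_tmul_toL2 (b c : B) (x : A) :
    bimoduleOperator hτ j (b ⊗ₜ op c) (toL2 hτ x) = toL2 hτ (j b * (x * j c)) := by
  change leftRep τ (j b) (rightRep hτ (op (j c)) (toL2 hτ x)) = _
  rw [rightRep_toL2, leftRep_toL2]

lemma bimoduleOperator_toL2_mem {V : Submodule ℂ A} (hV : IsBimodule j V) (u : B ⊗[ℂ] Bᵐᵒᵖ)
    (x : A) (hx : x ∈ V) : bimoduleOperator hτ j u (toL2 hτ x) ∈ L2Of hτ V := by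
  induction u with
  | zero => simp [bimoduleOperator]
  | tmul b c =>
    rw [← op_unop c, bimoduleOperator_tmul_toL2]
    exact Submodule.le_topologicalClosure _
      (Submodule.mem_map_of_mem (hV _ _ (hV _ _ hx).2).1)
  | add u v hu hv =>
    simpa [bimoduleOperator] using add_mem hu hv

/-- `Q₀(∑ b_j c_j^op)` as an element of `B(V, L²(V))`, where the `B`-`B`-invariant subspace `V`
carries the norm of `A` and `L²(V)` that of `L²(A)`. -/
def bimoduleMap {V : Submodule ℂ A} (hV : IsBimodule j V) (u : B ⊗[ℂ] Bᵐᵒᵖ) :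
    V →L[ℂ] L2Of hτ V :=
  ((Q0 hτ (bimoduleOperator hτ j u)).comp V.subtypeL).codRestrict (L2Of hτ V)
    fun x => bimoduleOperator_toL2_mem hτ j hV u x x.2

end IsFaithfulTracialState

namespace VonNeumannAlgebra

variable {H : Type*} [NormedAddCommGroup H] [InnerProductSpace ℂ H] [CompleteSpace H]

/-! ### A von Neumann algebra as an ordered C⋆-algebra -/

instance isClosed_toStarSubalgebra (M : VonNeumannAlgebra H) :
    IsClosed (M.toStarSubalgebra : Set (H →L[ℂ] H)) := by
  rw [coe_toStarSubalgebra, ← centralizer_centralizer M]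
  exact Set.isClosed_centralizer _

/-- Every positive element of a von Neumann algebra is `s⋆ s` with `s` in the algebra. -/
lemma exists_star_mul_self_of_nonneg (M : VonNeumannAlgebra H) (a : M.toStarSubalgebra)
    (ha : 0 ≤ (a : H →L[ℂ] H)) : ∃ s : M.toStarSubalgebra, a = star s * s := by
  have hs : CFC.sqrt (a : H →L[ℂ] H) ∈ M := by
    rw [← SetLike.mem_coe, ← centralizer_centralizer M, Set.mem_centralizer_iff]
    intro y hy
    have hc : Commute (a : H →L[ℂ] H) y := (Set.mem_centralizer_iff.mp hy) _ a.2
    exact (hc.cfcₙ_nnreal _).symm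
  refine ⟨⟨CFC.sqrt (a : H →L[ℂ] H), hs⟩, Subtype.ext ?_⟩
  change (a : H →L[ℂ] H) = star (CFC.sqrt (a : H →L[ℂ] H)) * CFC.sqrt (a : H →L[ℂ] H)
  rw [(CFC.sqrt_nonneg (a : H →L[ℂ] H)).isSelfAdjoint.star_eq, CFC.sqrt_mul_sqrt_self _ ha]

instance starOrderedRing_toStarSubalgebra (M : VonNeumannAlgebra H) :
    StarOrderedRing M.toStarSubalgebra :=
  StarOrderedRing.of_le_iff fun x y => by
    constructor
    · intro h
      have h' : (0 : H →L[ℂ] H) ≤ ((y - x : M.toStarSubalgebra) : H →L[ℂ] H) :=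
        sub_nonneg.mpr (show (x : H →L[ℂ] H) ≤ y from h)
      obtain ⟨s, hs⟩ := M.exists_star_mul_self_of_nonneg (y - x) h'
      exact ⟨s, by rw [← hs]; abel⟩
    · rintro ⟨s, rfl⟩
      change (x : H →L[ℂ] H) ≤ (x : H →L[ℂ] H) + star (s : H →L[ℂ] H) * (s : H →L[ℂ] H)
      exact le_add_of_nonneg_right (star_mul_self_nonneg _)

/-- `τ` is a faithful normal tracial state on `M`. Normality: `τ` preserves suprema of bounded
increasing families of positive elements. -/
structure IsFaithfulNormalTracialState (M : VonNeumannAlgebra H)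
    (τ : M.toStarSubalgebra →ₚ[ℂ] ℂ) : Prop extends IsFaithfulTracialState τ where
  normal : ∀ (S : Set M.toStarSubalgebra) (x : M.toStarSubalgebra), S.Nonempty →
    DirectedOn (· ≤ ·) S → (∀ y ∈ S, 0 ≤ y) → IsLUB S x → IsLUB (τ '' S) (τ x)

end VonNeumannAlgebra

end

/-!
The elements of the spaces `V i` form orthogonal families in `L²(M)`. Choose `x i ∈ V i` with
`‖x i‖ ≤ 1` in `M` and `‖S (x i)‖₂ > r m`, where `S = ∑ b_j c_j^op`, `m` is the minimal tensor norm
of `u = ∑ b_j ⊗ c_j^op`, and `r = 1 + δ / 2`. An orthogonal bounded sequence is weakly null, and an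
operator `K` with `Q₀(K)` compact maps a weakly null sequence that is bounded in `M` to a sequence
with norms arbitrarily close to `0` (`exists_norm_apply_lt_of_mem_compactLeftIdeal`). Hence the
vectors `x i` cannot see the elements of `𝒦`, and any lower bound for `‖T (x i)‖₂` that is uniform
in `i` is a lower bound for the norm of `T` in `ℳ(𝒦) ⧸ 𝒦` (`le_norm_theta`).

A bounded `θ` is a homomorphism of C⋆-algebras, hence contractive, which would already contradict
the bound `r m` at `u`. The proof runs the power trick behind contractivity on vectors instead of
in the quotient: for `T = (S⋆ S) ^ 2 ^ k` the Cauchy–Schwarz inequality gives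
`(r m) ^ (2 * 2 ^ k) ≤ ‖T (x i)‖₂` (`pow_le_norm_star_mul_self_pow_apply`), while
`(u⋆ u) ^ 2 ^ k` has minimal tensor norm at most `m ^ (2 * 2 ^ k)`. If `θ` were bounded by `C`,
then `r ^ (2 * 2 ^ k) ≤ C` for all `k`, since `m > 0` by injectivity of the spatial representation
(`spatialRep_injective`); this is absurd because `r > 1`.
-/

open scoped ComplexOrder TensorProduct InnerProductSpace
open UniformSpace MulOpposite Filter Topology

/-! ### Operators and orthogonal sequences in a Hilbert space -/

section HilbertSpace

variable {E : Type*} [NormedAddCommGroup E] [InnerProductSpace ℂ E]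

/-- A bounded orthogonal sequence is weakly null, by Bessel's inequality. -/
lemma tendsto_inner_of_pairwise_orthogonal {x : ℕ → E} {R : ℝ} (hx : ∀ i, ‖x i‖ ≤ R)
    (hx0 : ∀ i, x i ≠ 0) (horth : Pairwise fun i j => ⟪x i, x j⟫_ℂ = 0) (ξ : E) :
    Tendsto (fun i => ⟪x i, ξ⟫_ℂ) atTop (𝓝 0) := by
  have he : Orthonormal ℂ fun i => ((‖x i‖⁻¹ : ℝ) : ℂ) • x i :=
    ⟨fun i => by simp [norm_smul, hx0 i], fun i j hij => by
      have h : ⟪x i, x j⟫_ℂ = 0 := horth hij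
      simp [inner_smul_left, inner_smul_right, h]⟩
  have h := he.inner_products_summable (x := ξ) |>.tendsto_atTop_zero
  have h' : Tendsto (fun i => R * ‖⟪((‖x i‖⁻¹ : ℝ) : ℂ) • x i, ξ⟫_ℂ‖) atTop (𝓝 0) := by
    simpa only [Real.sqrt_sq (norm_nonneg _), Real.sqrt_zero, mul_zero] using h.sqrt.const_mul R
  refine squeeze_zero_norm (fun i => ?_) h'
  have hpos : 0 < ‖x i‖ := norm_pos_iff.mpr (hx0 i)
  calc ‖⟪x i, ξ⟫_ℂ‖ = ‖x i‖ * ‖⟪((‖x i‖⁻¹ : ℝ) : ℂ) • x i, ξ⟫_ℂ‖ := by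
        rw [inner_smul_left, norm_mul, RCLike.norm_conj, Complex.norm_real, norm_inv, norm_norm,
          mul_inv_cancel_left₀ hpos.ne']
    _ ≤ _ := by gcongr; exact hx i

/-- No completeness is assumed, so that this applies to an algebraic tensor product of Hilbert
spaces, where adjoints need not exist a priori. -/
lemma norm_le_of_formal_adjoint {S S' : E →L[ℂ] E} (h : ∀ x y, ⟪S x, y⟫_ℂ = ⟪x, S' y⟫_ℂ) :
    ‖S'‖ ≤ ‖S‖ := by
  refine S'.opNorm_le_bound (norm_nonneg S) fun y => ?_
  have hle : ‖S' y‖ * ‖S' y‖ ≤ ‖S' y‖ * (‖S‖ * ‖y‖) := by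
    calc ‖S' y‖ * ‖S' y‖ = ‖⟪S (S' y), y⟫_ℂ‖ := by
          rw [h, ← inner_self_eq_norm_mul_norm (𝕜 := ℂ), inner_self_re_eq_norm]
      _ ≤ ‖S (S' y)‖ * ‖y‖ := norm_inner_le_norm _ _
      _ ≤ ‖S‖ * ‖S' y‖ * ‖y‖ := by gcongr; exact S.le_opNorm _
      _ = _ := by ring
  rcases (norm_nonneg (S' y)).eq_or_lt' with hz | hz
  · rw [hz]; positivity
  · exact le_of_mul_le_mul_left hle hz

lemma norm_mul_pow_le_of_formal_adjoint {S S' : E →L[ℂ] E}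
    (h : ∀ x y, ⟪S x, y⟫_ℂ = ⟪x, S' y⟫_ℂ) {N : ℕ} (hN : 0 < N) :
    ‖(S' * S) ^ N‖ ≤ ‖S‖ ^ (2 * N) := by
  rw [pow_mul, sq]
  refine (norm_pow_le' _ hN).trans ?_
  gcongr
  exact (norm_mul_le _ _).trans (by gcongr; exact norm_le_of_formal_adjoint h)

variable [CompleteSpace E]

lemma sq_norm_apply_le_norm_star_mul_self_apply (S : E →L[ℂ] E) {x : E} (hx : ‖x‖ ≤ 1) :
    ‖S x‖ ^ 2 ≤ ‖(star S * S) x‖ := by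
  rw [sq, ← inner_self_eq_norm_mul_norm (𝕜 := ℂ), inner_self_re_eq_norm,
    ← ContinuousLinearMap.adjoint_inner_right]
  exact (norm_inner_le_norm _ _).trans (mul_le_of_le_one_left (norm_nonneg _) hx)

/-- Iterated Cauchy–Schwarz: each squaring of the self-adjoint operator `(S⋆ S) ^ 2 ^ k` at least
squares the norm of its value at `x`. -/
lemma pow_le_norm_star_mul_self_pow_apply (S : E →L[ℂ] E) {x : E} (hx : ‖x‖ ≤ 1) (k : ℕ) :
    ‖S x‖ ^ (2 * 2 ^ k) ≤ ‖((star S * S) ^ 2 ^ k) x‖ := by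
  induction k with
  | zero => simpa using sq_norm_apply_le_norm_star_mul_self_apply S hx
  | succ k ih =>
    have hsa : star ((star S * S) ^ 2 ^ k) = (star S * S) ^ 2 ^ k := by simp
    have h := sq_norm_apply_le_norm_star_mul_self_apply ((star S * S) ^ 2 ^ k) hx
    rw [hsa, ← pow_add, ← two_mul, ← pow_succ'] at h
    refine le_trans ?_ h
    rw [pow_succ, ← mul_assoc, pow_mul]
    gcongr

end HilbertSpace

/-! ### The spatial representation of an algebraic tensor product -/

section SpatialRep

variable {A₁ A₂ H₁ H₂ : Type*}
  [NormedAddCommGroup H₁] [InnerProductSpace ℂ H₁] [CompleteSpace H₁]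
  [NormedAddCommGroup H₂] [InnerProductSpace ℂ H₂] [CompleteSpace H₂]
  [Ring A₁] [StarRing A₁] [Algebra ℂ A₁] [Ring A₂] [StarRing A₂] [Algebra ℂ A₂]
  (π : A₁ →⋆ₐ[ℂ] (H₁ →L[ℂ] H₁)) (ρ : A₂ →⋆ₐ[ℂ] (H₂ →L[ℂ] H₂))

lemma spatialRep_tmul (a : A₁) (b : A₂) :
    spatialRep π ρ (a ⊗ₜ b) = TensorProduct.mapL (π a) (ρ b) := rfl

/-- The spatial representation as a homomorphism of algebras. -/
noncomputable def spatialRepAlgHom : A₁ ⊗[ℂ] A₂ →ₐ[ℂ] (H₁ ⊗[ℂ] H₂ →L[ℂ] H₁ ⊗[ℂ] H₂) :=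
  Algebra.TensorProduct.algHomOfLinearMapTensorProduct (spatialRep π ρ)
    (fun a₁ a₂ b₁ b₂ => by simp only [spatialRep_tmul, map_mul, TensorProduct.mapL_mul])
    (by
      rw [spatialRep_tmul, map_one, map_one]
      exact TensorProduct.mapL_id_id)

lemma spatialRepAlgHom_apply (u : A₁ ⊗[ℂ] A₂) : spatialRepAlgHom π ρ u = spatialRep π ρ u := rfl

lemma inner_spatialRep_left [StarModule ℂ A₁] [StarModule ℂ A₂] (u : A₁ ⊗[ℂ] A₂)
    (x y : H₁ ⊗[ℂ] H₂) :
    ⟪spatialRep π ρ u x, y⟫_ℂ = ⟪x, spatialRep π ρ (star u) y⟫_ℂ := by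
  induction u with
  | zero => simp
  | add u v hu hv => simp [inner_add_left, inner_add_right, hu, hv]
  | tmul a b =>
    rw [TensorProduct.star_tmul, spatialRep_tmul, spatialRep_tmul, map_star, map_star,
      ContinuousLinearMap.star_eq_adjoint, ContinuousLinearMap.star_eq_adjoint]
    induction x with
    | zero => simp
    | add x x' hx hx' => rw [map_add, inner_add_left, inner_add_left, hx, hx']
    | tmul ξ η =>
      induction y with
      | zero => simp
      | add y y' hy hy' => rw [map_add, inner_add_right, inner_add_right, hy, hy']
      | tmul ξ' η' =>
        rw [TensorProduct.mapL_tmul, TensorProduct.mapL_tmul, TensorProduct.inner_tmul,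
          TensorProduct.inner_tmul, ContinuousLinearMap.adjoint_inner_right,
          ContinuousLinearMap.adjoint_inner_right]

lemma minTensorNorm_star_mul_self_pow_le [StarModule ℂ A₁] [StarModule ℂ A₂] (u : A₁ ⊗[ℂ] A₂)
    {N : ℕ} (hN : 0 < N) :
    minTensorNorm π ρ ((star u * u) ^ N) ≤ minTensorNorm π ρ u ^ (2 * N) := by
  have h : spatialRep π ρ ((star u * u) ^ N) =
      (spatialRep π ρ (star u) * spatialRep π ρ u) ^ N := by
    simp only [← spatialRepAlgHom_apply, map_pow, map_mul]
  rw [minTensorNorm, h]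
  exact norm_mul_pow_le_of_formal_adjoint (inner_spatialRep_left π ρ u) hN

/-- Slicing `∑ a_i ⊗ e_i`, with `e` a basis, by a vector functional of `H₁` leaves a linear
combination of the `e_i`, so each coefficient `a_i` vanishes on vectors. -/
lemma spatialRep_injective (hπ : Function.Injective π) (hρ : Function.Injective ρ) :
    Function.Injective (spatialRep π ρ) := by
  refine (injective_iff_map_eq_zero _).mpr fun u hu => ?_
  let e := Module.Basis.ofVectorSpace ℂ A₂
  obtain ⟨f, rfl⟩ := TensorProduct.eq_repr_basis_right e u
  have hf : f = 0 := by
    ext i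
    refine hπ (ContinuousLinearMap.ext fun ξ => ext_inner_left ℂ fun ξ' => ?_)
    have hsum : f.sum (fun i a => ⟪ξ', π a ξ⟫_ℂ • e i) = 0 := by
      refine hρ (ContinuousLinearMap.ext fun η => ext_inner_left ℂ fun η' => ?_)
      have h := congrArg (fun T => ⟪ξ' ⊗ₜ[ℂ] η', T (ξ ⊗ₜ[ℂ] η)⟫_ℂ) hu
      simpa [Finsupp.sum, map_sum, spatialRep_tmul, TensorProduct.mapL_tmul, inner_sum,
        inner_smul_right, sum_apply] using h
    by_cases hi : i ∈ f.support
    · simpa using linearIndependent_iff'.mp e.linearIndependent f.support _ hsum i hi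
    · simp [Finsupp.notMem_support_iff.mp hi]
  simp [hf]

lemma minTensorNorm_pos (hπ : Function.Injective π) (hρ : Function.Injective ρ)
    {u : A₁ ⊗[ℂ] A₂} (hu : u ≠ 0) : 0 < minTensorNorm π ρ u := by
  refine (ContinuousLinearMap.opNorm_nonneg _).lt_of_ne' fun h => hu ?_
  exact spatialRep_injective π ρ hπ hρ
    (ContinuousLinearMap.ext fun x => norm_le_zero_iff.mp
      ((ContinuousLinearMap.le_opNorm _ x).trans (by rw [h]; simp)))

end SpatialRep

lemma opStarHom_injective {A B : Type*} [Ring A] [StarRing A] [Algebra ℂ A] [Ring B] [StarRing B]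
    [Algebra ℂ B] {f : B →⋆ₐ[ℂ] A} (hf : Function.Injective f) :
    Function.Injective (opStarHom f) := fun _ _ h => unop_injective (hf (congrArg unop h))

namespace IsFaithfulTracialState

variable {A : Type*} [CStarAlgebra A] [PartialOrder A] [StarOrderedRing A]
  {τ : A →ₚ[ℂ] ℂ} (hτ : IsFaithfulTracialState τ)

/-! ### Operators in the compactness ideal along orthogonal sequences -/

lemma norm_toL2_le (x : A) : ‖toL2 hτ x‖ ≤ ‖x‖ :=
  (Completion.norm_coe _).le.trans (norm_toPreGNS_le hτ x)

/-- Compactness of `Q₀(K)` gives a norm limit of a subsequence of `K (x i)`. It agrees with the weak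
limit, which is `0` because `K` is bounded on `L²(A)` and the `x i` are orthogonal there. -/
lemma exists_norm_apply_lt_of_mem_compactLeftIdeal {K : L2 τ →L[ℂ] L2 τ}
    (hK : K ∈ compactLeftIdeal hτ) {x : ℕ → A} (hx : ∀ i, ‖x i‖ ≤ 1) (hx0 : ∀ i, x i ≠ 0)
    (horth : Pairwise fun i j => τ (star (x i) * x j) = 0) {ε : ℝ} (hε : 0 < ε) :
    ∃ i, ‖K (toL2 hτ (x i))‖ < ε := by
  obtain ⟨C, hC, hCsub⟩ :=
    ((mem_compactLeftIdeal hτ).mp hK).image_subset_compact_of_bounded (f := (Q0 hτ K).toLinearMap)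
      (Metric.isBounded_closedBall (x := (0 : A)) (r := 1))
  have hmem : ∀ i, K (toL2 hτ (x i)) ∈ C := fun i =>
    hCsub ⟨x i, by simpa using hx i, rfl⟩
  obtain ⟨η, -, φ, hφ, hlim⟩ := hC.tendsto_subseq hmem
  have hweak := tendsto_inner_of_pairwise_orthogonal (x := fun i => toL2 hτ (x i))
    (fun i => (norm_toL2_le hτ (x i)).trans (hx i))
    (fun i => (map_ne_zero_iff _ (toL2_injective hτ)).mpr (hx0 i))
    (fun i j hij => (inner_toL2 hτ _ _).trans (horth hij)) (star K η)
  have hη : η = 0 := by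
    refine inner_self_eq_zero (𝕜 := ℂ).mp ?_
    refine tendsto_nhds_unique (hlim.inner tendsto_const_nhds)
      ((hweak.comp hφ.tendsto_atTop).congr fun i => ?_)
    exact ContinuousLinearMap.adjoint_inner_right K _ _
  have h0 := hlim.norm
  rw [hη, norm_zero] at h0
  obtain ⟨i, hi⟩ := (h0.eventually_lt_const hε).exists
  exact ⟨φ i, hi⟩

/-- A lower bound for `∑ a_j b_j^op` along an orthogonal sequence in the unit ball of `A` is a lower
bound for its quotient norm modulo `𝒦`. -/
lemma le_norm_theta (u : A ⊗[ℂ] Aᵐᵒᵖ) {x : ℕ → A} (hx : ∀ i, ‖x i‖ ≤ 1) (hx0 : ∀ i, x i ≠ 0)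
    (horth : Pairwise fun i j => τ (star (x i) * x j) = 0) {s : ℝ}
    (hs : ∀ i, s ≤ ‖(multiplierMap hτ u : L2 τ →L[ℂ] L2 τ) (toL2 hτ (x i))‖) :
    s ≤ ‖theta hτ u‖ := by
  refine le_of_forall_pos_le_add fun ε hε => ?_
  obtain ⟨T, hT, hTn⟩ := Submodule.Quotient.norm_mk_lt (theta hτ u) (half_pos hε)
  have hK : multiplierMap hτ u - T ∈ compactIdeal hτ :=
    (Submodule.Quotient.eq _).mp hT.symm
  obtain ⟨i, hi⟩ := exists_norm_apply_lt_of_mem_compactLeftIdeal hτ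
    (show ((multiplierMap hτ u - T : multiplierAlgebra hτ) : L2 τ →L[ℂ] L2 τ) ∈
      compactLeftIdeal hτ from hK.1) hx hx0 horth (half_pos hε)
  set ξ := toL2 hτ (x i)
  have hξ : ‖ξ‖ ≤ 1 := (norm_toL2_le hτ (x i)).trans (hx i)
  have hTξ : ‖(T : L2 τ →L[ℂ] L2 τ) ξ‖ ≤ ‖T‖ :=
    ((T : L2 τ →L[ℂ] L2 τ).le_opNorm ξ).trans (mul_le_of_le_one_right (norm_nonneg _) hξ)
  calc s ≤ ‖(multiplierMap hτ u : L2 τ →L[ℂ] L2 τ) ξ‖ := hs i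
    _ = ‖((multiplierMap hτ u - T : multiplierAlgebra hτ) : L2 τ →L[ℂ] L2 τ) ξ +
          (T : L2 τ →L[ℂ] L2 τ) ξ‖ := by simp
    _ ≤ ε / 2 + (‖theta hτ u‖ + ε / 2) :=
        (norm_add_le _ _).trans (add_le_add hi.le (hTξ.trans hTn.le))
    _ = ‖theta hτ u‖ + ε := by ring

/-! ### The multiplier map as a ⋆-homomorphism -/

lemma commute_leftRep_rightRep (a : A) (b : Aᵐᵒᵖ) : Commute (leftRep τ a) (rightRep hτ b) := by
  refine ContinuousLinearMap.ext fun ξ => (denseRange_toL2 hτ).induction_on ξ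
    (isClosed_eq (ContinuousLinearMap.continuous _) (ContinuousLinearMap.continuous _)) fun x => ?_
  change leftRep τ a (rightRep hτ (op (unop b)) _) = rightRep hτ (op (unop b)) (leftRep τ a _)
  rw [rightRep_toL2, leftRep_toL2, leftRep_toL2, rightRep_toL2, mul_assoc]

/-- The map `a ⊗ b^op ↦ a b^op` as a homomorphism of algebras with values in `B(L²(A))`. -/
noncomputable def multiplierAlgHom : A ⊗[ℂ] Aᵐᵒᵖ →ₐ[ℂ] (L2 τ →L[ℂ] L2 τ) :=
  Algebra.TensorProduct.lift (leftRep τ).toAlgHom (rightRep hτ).toAlgHom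
    (commute_leftRep_rightRep hτ)

lemma coe_multiplierMap (u : A ⊗[ℂ] Aᵐᵒᵖ) :
    (multiplierMap hτ u : L2 τ →L[ℂ] L2 τ) = multiplierAlgHom hτ u := by
  induction u with
  | zero => simp
  | add u v hu hv => simp [hu, hv]
  | tmul a b => rfl

lemma multiplierAlgHom_star (u : A ⊗[ℂ] Aᵐᵒᵖ) :
    multiplierAlgHom hτ (star u) = star (multiplierAlgHom hτ u) := by
  induction u with
  | zero => simp
  | add u v hu hv => simp [hu, hv]
  | tmul a b =>
    change leftRep τ (star a) * rightRep hτ (star b) = star (leftRep τ a * rightRep hτ b)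
    rw [star_mul, map_star, map_star, ← map_star, ← map_star]
    exact commute_leftRep_rightRep hτ _ _

lemma multiplierAlgHom_star_mul_self_pow (u : A ⊗[ℂ] Aᵐᵒᵖ) (N : ℕ) :
    multiplierAlgHom hτ ((star u * u) ^ N) =
      (star (multiplierAlgHom hτ u) * multiplierAlgHom hτ u) ^ N := by
  have h : multiplierAlgHom hτ (star u * u) =
      star (multiplierAlgHom hτ u) * multiplierAlgHom hτ u := by
    rw [← multiplierAlgHom_star]
    exact map_mul _ _ _
  rw [← h]
  induction N with
  | zero =>
    rw [pow_zero, pow_zero]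
    exact (multiplierAlgHom hτ).map_one'
  | succ N ih =>
    rw [pow_succ, pow_succ, ← ih]
    exact map_mul _ _ _

/-! ### Bimodules on which a subalgebra tensor exceeds its minimal norm -/

variable {B : Type*} [Ring B] [StarRing B] [Algebra ℂ B] (j : B →⋆ₐ[ℂ] A)

lemma subalgebraMinNorm_eq (u : B ⊗[ℂ] Bᵐᵒᵖ) :
    subalgebraMinNorm hτ j u = minTensorNorm (leftRep τ) (rightRep hτ)
      (TensorProduct.map j.toAlgHom.toLinearMap (opStarHom j).toAlgHom.toLinearMap u) := by
  refine congrArg norm ?_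
  induction u with
  | zero => simp
  | add u v hu hv => simp only [map_add, hu, hv]
  | tmul a b => rfl

/-- The criterion for a C⋆-algebra `A` with a faithful tracial state and an injective
`⋆`-homomorphism `j : B → A`: the argument is norm-theoretic and needs no weak topology. -/
theorem not_hasWStarAO_of_bimodules (hj : Function.Injective j) (V : ℕ → Submodule ℂ A)
    (hV : ∀ i, IsBimodule j (V i))
    (horth : ∀ i j, i ≠ j → ∀ x ∈ V i, ∀ y ∈ V j, τ (star y * x) = 0)
    {u : B ⊗[ℂ] Bᵐᵒᵖ} (hu : u ≠ 0) {δ : ℝ} (hδ : 0 < δ)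
    (hnorm : ∀ i, (1 + δ) * subalgebraMinNorm hτ j u ≤ ‖bimoduleMap hτ j (hV i) u‖) :
    ¬ HasWStarAO hτ := by
  rintro ⟨C, hC⟩
  set m := subalgebraMinNorm hτ j u with hm
  have hm0 : 0 < m := minTensorNorm_pos ((leftRep τ).comp j) ((rightRep hτ).comp (opStarHom j))
    (fun _ _ h => hj (leftRep_injective hτ h))
    (fun _ _ h => opStarHom_injective hj (rightRep_injective hτ h)) hu
  set v := TensorProduct.map j.toAlgHom.toLinearMap (opStarHom j).toAlgHom.toLinearMap u
  -- Half of the margin `δ` is spent on choosing almost norming vectors.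
  set r := 1 + δ / 2 with hr
  have hex : ∀ i, ∃ y : V i, ‖y‖ < 1 ∧ r * m < ‖bimoduleMap hτ j (hV i) u y‖ := fun i =>
    (bimoduleMap hτ j (hV i) u).exists_lt_apply_of_lt_opNorm
      ((mul_lt_mul_of_pos_right (by rw [hr]; linarith) hm0).trans_le (hnorm i))
  choose y hy1 hy2 using hex
  have hy3 : ∀ i, r * m < ‖multiplierAlgHom hτ v (toL2 hτ (y i))‖ := fun i => by
    rw [← coe_multiplierMap]
    exact hy2 i
  have hrm : 0 ≤ r * m := by positivity
  have hy0 : ∀ i, (y i : A) ≠ 0 := fun i h => by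
    have := hy3 i
    rw [h, map_zero, map_zero, norm_zero] at this
    exact this.not_ge hrm
  have hyn : ∀ i, ‖(y i : A)‖ ≤ 1 := fun i => (hy1 i).le
  have key : ∀ k : ℕ, r ^ (2 * 2 ^ k) ≤ C := fun k => by
    have h1 : (r * m) ^ (2 * 2 ^ k) ≤ ‖theta hτ ((star v * v) ^ 2 ^ k)‖ := by
      refine le_norm_theta hτ _ hyn hy0
        (fun i l hil => horth l i hil.symm _ (y l).2 _ (y i).2) fun i => ?_
      rw [coe_multiplierMap, multiplierAlgHom_star_mul_self_pow]
      refine le_trans ?_ (pow_le_norm_star_mul_self_pow_apply (multiplierAlgHom hτ v)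
        ((norm_toL2_le hτ _).trans (hyn i)) k)
      exact pow_le_pow_left₀ hrm (hy3 i).le _
    have hpos : 0 < r ^ (2 * 2 ^ k) * m ^ (2 * 2 ^ k) := by positivity
    have h2 := h1.trans (hC _)
    rw [mul_pow] at h2
    have hle := minTensorNorm_star_mul_self_pow_le (leftRep τ) (rightRep hτ) v
      (pow_pos two_pos k : 0 < 2 ^ k)
    rw [← subalgebraMinNorm_eq, ← hm] at hle
    have hC0 : 0 ≤ C := by
      by_contra! hneg
      exact (hpos.trans_le h2).not_ge
        (mul_nonpos_of_nonpos_of_nonneg hneg.le (ContinuousLinearMap.opNorm_nonneg _))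
    exact le_of_mul_le_mul_right (h2.trans (mul_le_mul_of_nonneg_left hle hC0))
      (pow_pos hm0 _)
  have hr1 : 1 < r := by rw [hr]; linarith
  obtain ⟨k, hk⟩ := pow_unbounded_of_one_lt C hr1
  have hk' : k ≤ 2 * 2 ^ k := (Nat.lt_two_pow_self (n := k)).le.trans (by omega)
  exact ((key k).trans_lt hk).not_ge (pow_le_pow_right₀ hr1.le hk')

end IsFaithfulTracialState

open VonNeumannAlgebra IsFaithfulTracialState in
theorem mainTheorem3 {H : Type*} [NormedAddCommGroup H] [InnerProductSpace ℂ H] [CompleteSpace H]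
    (M : VonNeumannAlgebra H) (τ : M.toStarSubalgebra →ₚ[ℂ] ℂ)
    (hτ : IsFaithfulNormalTracialState M τ)
    (B : VonNeumannAlgebra H) (hB : B.toStarSubalgebra ≤ M.toStarSubalgebra)
    (V : ℕ → Submodule ℂ M.toStarSubalgebra)
    (hV : ∀ i, IsBimodule (StarSubalgebra.inclusion hB) (V i))
    (horth : ∀ i j, i ≠ j → ∀ x ∈ V i, ∀ y ∈ V j, τ (star y * x) = 0)
    (n : ℕ) (b c : Fin n → B.toStarSubalgebra)
    (hbc : ∑ j, b j ⊗ₜ[ℂ] op (c j) ≠ 0)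
    (δ : ℝ) (hδ : 0 < δ)
    (hnorm : ∀ i, (1 + δ) * subalgebraMinNorm hτ.toIsFaithfulTracialState
        (StarSubalgebra.inclusion hB) (∑ j, b j ⊗ₜ[ℂ] op (c j)) ≤
      ‖bimoduleMap hτ.toIsFaithfulTracialState (StarSubalgebra.inclusion hB) (hV i)
        (∑ j, b j ⊗ₜ[ℂ] op (c j))‖) :
    ¬ HasWStarAO hτ.toIsFaithfulTracialState :=
  not_hasWStarAO_of_bimodules hτ.toIsFaithfulTracialState (StarSubalgebra.inclusion hB)
    (StarSubalgebra.inclusion_injective hB) V hV horth hbc hδ hnorm
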